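/- **Proposition 4.5 (The Derivative of Dynamic Rays).** *Setting.* For $\kappa\in\mathbb C$ let $E_\kappa(z)=\exp(z+\kappa)$, let $F(t)=e^t-1$ on $[0,\infty)$, and let $\sigma$ be the shift on sequences $\underline s=(s_1,s_2,\dots)$ of integers. Let $\mathcal S_0$ be the set of exponentially bounded sequences: those for which there is an $x>0$ with $|s_{k+1}|\le F^{\circ k}(x)$ for all $k\ge 0$. For $\underline s\in\mathcal S_0$ put $$t_{\underline s}=\inf\Bigl\{x>0:\ \limsup_{n\to\infty}\frac{|s_n|}{F^{\circ(n-1)}(x)}=0\Bigr\},\qquad t^*_{\underline s}=\sup_{n\ge1}F^{\circ(-n+1)}(|s_n|).$$ Let $L_{\kappa,j}(z)=\operatorname{Log}z-\kappa+2\pi i j$ with the principal logarithm. For $t\ge t^*_{\underline s}+2\log(|\kappa|+3)$ the dynamic ray at external address $\underline s$ is $$g^\kappa_{\underline s}(t)=\lim_{n\to\infty}L_{\kappa,s_1}\circ\dots\circ L_{\kappa,s_n}(F^{\circ n}(t)).$$ It is extended to lower potentials $t>t_{\underline s}$ by continuous pull-back along $E_\kappa\circ g^\kappa_{\underline s}=g^\kappa_{\sigma\underline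 s}\circ F$. It is defined at all $t>t_{\underline s}$ except those for which there are $n\ge1$ and $t'\ge F^{\circ n}(t)$ such that $g^\kappa_{\sigma^n\underline s}(t')$ is defined and equal to $0$. A property $P(\kappa,\underline s,t)$ is said to hold *on ray tails* if there are constants $A,B,C\ge0$ such that for all $\underline s\in\mathcal S_0$ and all $K\ge1$ it holds whenever $|\kappa|\le K$ and $t\ge A t^*_{\underline s}+B\log K+C$. *Statement.* For every $\underline s\in\mathcal S_0$ and every $\kappa\in\mathbb C$, the dynamic ray $g^\kappa_{\underline s}$ is continuously differentiable with respect to the potential $t$ wherever it is defined, with derivative given by the convergent infinite product $$(g^\kappa_{\underline s})'(t)=\prod_{k=1}^\infty\frac{F^{\circ k}(t)+1}{g^\kappa_{\sigma^k\underline s}(F^{\circ k}(t))}\ \neq\ 0.$$ Moreover, on ray tails, $g^\kappa_{\underline s}(t)$ is defined and $$\bigl|(g^\kappa_{\underline s})'(t)-1\bigr|<e^{-t/2}.$$ -/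

import Mathlib

open Filter Topology Set

namespace ExpRay

noncomputable section

/-- The exponential map `E_κ(z) = exp (z + κ)`. -/
def E (κ z : ℂ) : ℂ := Complex.exp (z + κ)

/-- The model function `F(t) = e^t - 1` for exponential growth. -/
def F (t : ℝ) : ℝ := Real.exp t - 1

/-- The inverse of `F` on `[0, ∞)`. -/
def Finv (x : ℝ) : ℝ := Real.log (1 + x)

/-- External addresses `(s₁, s₂, s₃, …)` are functions `s : ℕ → ℤ`, where `s n` is the entry
`s_{n+1}`; this is the shift map. -/
def shift (s : ℕ → ℤ) : ℕ → ℤ := fun n => s (n + 1)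

/-- Exponential boundedness: there is `x > 0` with `|s_{k+1}| ≤ F^{∘k}(x)` for all `k ≥ 0`. -/
def ExpBounded (s : ℕ → ℤ) : Prop :=
  ∃ x : ℝ, 0 < x ∧ ∀ k : ℕ, |(s k : ℝ)| ≤ F^[k] x

/-- The minimal potential `t_s`, the infimum of all `x > 0` for which
`limsup |s_n| / F^{∘(n-1)}(x) = 0`. The quotients are nonnegative, so that this condition says
that they tend to `0`. -/
def minPotential (s : ℕ → ℤ) : ℝ :=
  sInf {x : ℝ | 0 < x ∧ Tendsto (fun n : ℕ => |(s n : ℝ)| / F^[n] x) atTop (𝓝 0)}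

/-- `t_s^* = sup_{n ≥ 1} F^{∘(-n+1)}(|s_n|)`, a supremum of a bounded set of reals for
exponentially bounded `s`. -/
def tStar (s : ℕ → ℤ) : ℝ := ⨆ n : ℕ, Finv^[n] |(s n : ℝ)|

/-- The branch `L_{κ,j}(z) = Log z - κ + 2πij` of the inverse of `E_κ`. -/
def L (κ : ℂ) (j : ℤ) (z : ℂ) : ℂ :=
  Complex.log z - κ + 2 * Real.pi * Complex.I * j

/-- The approximations `g^n_{κ,s}(t) = L_{κ,s₁} ∘ ⋯ ∘ L_{κ,s_n} (F^{∘n}(t))`. -/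
def approx (κ : ℂ) : ℕ → (ℕ → ℤ) → ℝ → ℂ
  | 0, _, t => (t : ℂ)
  | n + 1, s, t => L κ (s 0) (approx κ n (shift s) (F t))

/-- `t_s^K = t_s^* + 2 log (K + 3)` for `K = |κ|`. At potentials `t ≥ t_s^K` the point of the
ray at external address `s` is the limit of the approximations `g^n_{κ,s}(t)`. -/
def tailStart (κ : ℂ) (s : ℕ → ℤ) : ℝ := tStar s + 2 * Real.log (‖κ‖ + 3)

/-- `h` parametrizes, on `[t, ∞)`, the dynamic ray of `E_κ` at external address `s`: it is
continuous there; at potentials `τ ≥ t_s^K` the point `h τ` is the limit of the approximations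
(case `n = 0`); and at all potentials `τ ≥ t`, the map `E_κ^{∘n}` sends `h τ` to the point of
potential `F^{∘n}(τ)` at address `σ^n s`, whenever that potential is large enough for this point
to be given as a limit of approximations. In other words, the part at large potentials is
extended to lower potentials by continuous pull-back along
`E_κ ∘ g_s = g_{σ s} ∘ F`. -/
def IsRayOn (κ : ℂ) (s : ℕ → ℤ) (t : ℝ) (h : ℝ → ℂ) : Prop :=
  ContinuousOn h (Ici t) ∧
    ∀ τ : ℝ, t ≤ τ → ∀ n : ℕ, tailStart κ (shift^[n] s) ≤ F^[n] τ →
      Tendsto (fun m : ℕ => approx κ m (shift^[n] s) (F^[n] τ)) atTop (𝓝 ((E κ)^[n] (h τ)))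

/-- `z` is the point of potential `t > t_s` on the dynamic ray at external address `s`, that is,
`g_s^κ(t)` is defined and equal to `z`. -/
def IsRayPoint (κ : ℂ) (s : ℕ → ℤ) (t : ℝ) (z : ℂ) : Prop :=
  minPotential s < t ∧ ∃ h : ℝ → ℂ, IsRayOn κ s t h ∧ h t = z

/-- The dynamic ray `t ↦ g_s^κ(t)` (with an arbitrary value where it is not defined). -/
def dynRay (κ : ℂ) (s : ℕ → ℤ) (t : ℝ) : ℂ := Classical.epsilon (IsRayPoint κ s t)

/-- The potentials at which `g_s^κ` is defined: all `t > t_s`, except those for which the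
singular value `0` lies on the ray at some address `σ^n s`, `n ≥ 1`, at some potential
`t' ≥ F^{∘n}(t)`. -/
def rayDomain (κ : ℂ) (s : ℕ → ℤ) : Set ℝ :=
  {t : ℝ | minPotential s < t ∧
    ∀ n : ℕ, 1 ≤ n → ∀ t' : ℝ, F^[n] t ≤ t' → ¬ IsRayPoint κ (shift^[n] s) t' 0}

/-- A property `P κ s t` holds on ray tails: there are `A, B, C ≥ 0` such that it holds for all
exponentially bounded `s`, all `K ≥ 1`, all `|κ| ≤ K` and all `t ≥ A t_s^* + B log K + C`. -/
def OnRayTails (P : ℂ → (ℕ → ℤ) → ℝ → Prop) : Prop :=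
  ∃ A B C : ℝ, 0 ≤ A ∧ 0 ≤ B ∧ 0 ≤ C ∧
    ∀ s : ℕ → ℤ, ExpBounded s → ∀ K : ℝ, 1 ≤ K → ∀ κ : ℂ, ‖κ‖ ≤ K →
      ∀ t : ℝ, A * tStar s + B * Real.log K + C ≤ t → P κ s t

end

end ExpRay

namespace ExpRay

/-! At high potentials the approximations are compositions of logarithms, which contract near large
positive numbers. They stay close to the potential (`norm_approx_sub_le`) and converge geometrically
(`norm_approx_add_two_sub_le`); the limit `tailRay` satisfies E_κ ∘ g_s = g_{σs} ∘ F. By the chain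
rule their derivatives are finite products of factors (F^k(t)+1)/g, with g an approximation at
potential F^k(t). Above `farStart` these products stay within e^{-t/2}/2 of 1
(`norm_approxDeriv_sub_one_le`) and converge uniformly (`norm_approxDeriv_succ_sub_le`). So
`tailRay` is C¹ there, its derivative is the infinite product (`hasProd_rayFactor`), and the
estimate on ray tails follows.

For t > t_s some F^N(t) exceeds `farStart` of σ^N s. At a potential in the domain the ray exists
slightly below it as well, because a pull-back needs only that 0 be avoided, an open condition
(`exists_isRayOn_of_mem_rayDomain`); it is unique because lifts through exp are (`IsRayOn.eqOn`).
Now g_s + κ is a continuous logarithm of g_{σs} ∘ F, hence C¹ if g_{σs} is, with derivative (F(t)+1)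
g_{σs}'(F(t)) / g_{σs}(F(t)). Each pull-back thus puts one nonzero factor in front of the product,
and induction on N concludes (`IsRayOn.contDiffAt_and_hasProd`). -/

/-! ### Growth of F and its inverse. -/

lemma F_zero : F 0 = 0 := by simp [F]

lemma strictMono_F : StrictMono F := fun _ _ h => sub_lt_sub_right (Real.exp_lt_exp.2 h) 1

lemma hasDerivAt_F (t : ℝ) : HasDerivAt F (F t + 1) t := by
  have h := (Real.hasDerivAt_exp t).sub_const 1
  have e : F t + 1 = Real.exp t := by simp [F]
  rw [e]; exact h

lemma continuous_F : Continuous F := Real.continuous_exp.sub continuous_const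

lemma self_add_sq_le_F {t : ℝ} (ht : 0 ≤ t) : t + t ^ 2 / 2 ≤ F t := by
  have := Real.quadratic_le_exp_of_nonneg ht
  simp only [F]; linarith

lemma self_le_F (t : ℝ) : t ≤ F t := by
  have := Real.add_one_le_exp t
  simp only [F]; linarith

lemma F_nonneg {t : ℝ} (ht : 0 ≤ t) : 0 ≤ F t := ht.trans (self_le_F t)

lemma add_F_le {a b : ℝ} (ha : 0 ≤ a) (hb : 0 ≤ b) : F a + F b ≤ F (a + b) := by
  have h1 := Real.one_le_exp ha
  have h2 := Real.one_le_exp hb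
  simp only [F, Real.exp_add]
  nlinarith

lemma Finv_F (t : ℝ) : Finv (F t) = t := by simp [F, Finv]

lemma F_Finv {x : ℝ} (hx : -1 < x) : F (Finv x) = x := by
  simp only [F, Finv]; rw [Real.exp_log (by linarith)]; ring

lemma Finv_nonneg {x : ℝ} (hx : 0 ≤ x) : 0 ≤ Finv x := Real.log_nonneg (by linarith)

lemma Finv_mono {x y : ℝ} (hx : 0 ≤ x) (h : x ≤ y) : Finv x ≤ Finv y :=
  Real.log_le_log (by linarith) (by linarith)

lemma iterate_Finv_nonneg {x : ℝ} (hx : 0 ≤ x) (n : ℕ) : 0 ≤ Finv^[n] x := by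
  induction n with
  | zero => exact hx
  | succ n ih => rw [Function.iterate_succ_apply']; exact Finv_nonneg ih

lemma iterate_Finv_mono {x y : ℝ} (hx : 0 ≤ x) (h : x ≤ y) (n : ℕ) :
    Finv^[n] x ≤ Finv^[n] y := by
  induction n with
  | zero => exact h
  | succ n ih =>
    rw [Function.iterate_succ_apply', Function.iterate_succ_apply']
    exact Finv_mono (iterate_Finv_nonneg hx n) ih

lemma iterate_Finv_F (n : ℕ) (x : ℝ) : Finv^[n] (F^[n] x) = x :=
  (Function.LeftInverse.iterate Finv_F n) x

lemma iterate_F_nonneg {x : ℝ} (hx : 0 ≤ x) (n : ℕ) : 0 ≤ F^[n] x := by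
  induction n with
  | zero => exact hx
  | succ n ih => rw [Function.iterate_succ_apply']; exact F_nonneg ih

lemma iterate_F_strictMono (n : ℕ) : StrictMono F^[n] := strictMono_F.iterate n

lemma tendsto_iterate_F {u : ℝ} (hu : 0 < u) : Tendsto (fun n => F^[n] u) atTop atTop := by
  have key : ∀ n : ℕ, u + n * (u ^ 2 / 2) ≤ F^[n] u := by
    intro n
    induction n with
    | zero => simp
    | succ n ih =>
      rw [Function.iterate_succ_apply']
      have h0 : u ≤ F^[n] u := le_trans (by nlinarith [Nat.cast_nonneg (α := ℝ) n, sq_nonneg u]) ih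
      have h1 := self_add_sq_le_F (hu.le.trans h0)
      push_cast
      nlinarith
  refine tendsto_atTop_mono key (tendsto_atTop_add_const_left _ _ ?_)
  exact tendsto_natCast_atTop_atTop.atTop_mul_const (by positivity)

/-- The gap between two orbits of `F` grows at least like an orbit of `F`. -/
lemma iterate_F_sub_le {x t : ℝ} (hx : 0 ≤ x) (h : x ≤ t) (n : ℕ) :
    F^[n] (t - x) ≤ F^[n] t - F^[n] x := by
  induction n with
  | zero => simp
  | succ n ih =>
    simp only [Function.iterate_succ_apply']
    have h0 := iterate_F_nonneg hx n
    have h1 := iterate_F_nonneg (sub_nonneg.2 h) n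
    have h2 := add_F_le h0 (h1.trans ih)
    rw [add_sub_cancel] at h2
    have h3 := strictMono_F.monotone ih
    linarith

/-- Orbits of `F` at different potentials eventually separate by any linear factor. -/
lemma eventually_iterate_F_lt {x t : ℝ} (hx : 0 ≤ x) (h : x < t) {A : ℝ} (hA : 0 ≤ A) (B : ℝ) :
    ∀ᶠ n in atTop, A * F^[n] x + B < F^[n] t := by
  have h1 := (tendsto_iterate_F (sub_pos.2 h)).eventually_ge_atTop (A + |B| + 1)
  obtain ⟨N, hN⟩ := eventually_atTop.1 h1
  refine eventually_atTop.2 ⟨N + 1, fun n hn => ?_⟩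
  obtain ⟨k, rfl⟩ : ∃ k, n = k + 1 := ⟨n - 1, by omega⟩
  have h2 := (hN k (by omega)).trans (iterate_F_sub_le hx h.le k)
  have h3 := iterate_F_nonneg hx (k + 1)
  -- The ratio of the two orbits (each plus 1) is the exponential of the previous gap, which is
  -- already large.
  have h4 : F^[k + 1] t + 1 =
      (F^[k + 1] x + 1) * Real.exp (F^[k] t - F^[k] x) := by
    simp only [Function.iterate_succ_apply', F, sub_add_cancel]
    rw [← Real.exp_add, add_sub_cancel]
  have h5 := Real.add_one_le_exp (F^[k] t - F^[k] x)
  have h6 := mul_le_mul_of_nonneg_left (show A + |B| + 2 ≤ _ by linarith)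
    (show 0 ≤ F^[k + 1] x + 1 by linarith)
  nlinarith [abs_nonneg B, le_abs_self B, mul_nonneg h3 (abs_nonneg B)]

/-! ### Exponentially bounded addresses and t^*. -/

lemma ExpBounded.shift {s : ℕ → ℤ} (hs : ExpBounded s) : ExpBounded (shift s) := by
  obtain ⟨x, hx, h⟩ := hs
  exact ⟨F x, hx.trans_le (self_le_F x), fun k => h (k + 1)⟩

lemma ExpBounded.iterate_shift {s : ℕ → ℤ} (hs : ExpBounded s) (n : ℕ) :
    ExpBounded (ExpRay.shift^[n] s) := by
  induction n generalizing s with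
  | zero => exact hs
  | succ n ih => exact ih hs.shift

lemma iterate_shift_apply (s : ℕ → ℤ) (n k : ℕ) : shift^[n] s k = s (n + k) := by
  induction n generalizing s with
  | zero => simp
  | succ n ih => rw [Function.iterate_succ_apply, ih]; simp only [shift]; congr 1; ring

lemma iterate_Finv_abs_le {s : ℕ → ℤ} {x : ℝ} {k : ℕ} (h : |(s k : ℝ)| ≤ F^[k] x) :
    Finv^[k] |(s k : ℝ)| ≤ x := by
  simpa only [iterate_Finv_F] using iterate_Finv_mono (abs_nonneg (s k : ℝ)) h k

lemma tStar_le {s : ℕ → ℤ} {x : ℝ} (h : ∀ k : ℕ, |(s k : ℝ)| ≤ F^[k] x) : tStar s ≤ x :=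
  ciSup_le fun k => iterate_Finv_abs_le (h k)

lemma tStar_nonneg (s : ℕ → ℤ) : 0 ≤ tStar s :=
  Real.iSup_nonneg fun k => iterate_Finv_nonneg (abs_nonneg _) k

lemma iterate_F_Finv {x : ℝ} (hx : 0 ≤ x) (n : ℕ) : F^[n] (Finv^[n] x) = x := by
  induction n generalizing x with
  | zero => rfl
  | succ n ih =>
    rw [Function.iterate_succ_apply', Function.iterate_succ_apply, ih (Finv_nonneg hx),
      F_Finv (by linarith)]

/-- With `tStar_le`: t^* is the least bound x in the definition of exponential boundedness, up to
the case x = 0. -/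
lemma ExpBounded.abs_le {s : ℕ → ℤ} (hs : ExpBounded s) (k : ℕ) :
    |(s k : ℝ)| ≤ F^[k] (tStar s) := by
  obtain ⟨x, hx, h⟩ := hs
  have hb : BddAbove (range fun n : ℕ => Finv^[n] |(s n : ℝ)|) :=
    ⟨x, by rintro _ ⟨k, rfl⟩; exact iterate_Finv_abs_le (h k)⟩
  have := (iterate_F_strictMono k).monotone (le_ciSup hb k)
  rwa [iterate_F_Finv (abs_nonneg (s k : ℝ))] at this

lemma ExpBounded.tStar_shift_le {s : ℕ → ℤ} (hs : ExpBounded s) :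
    tStar (ExpRay.shift s) ≤ F (tStar s) :=
  tStar_le fun k => hs.abs_le (k + 1)

/-! ### The logarithm near large positive numbers. -/

lemma mem_slitPlane_of_norm_sub_le {T : ℝ} (hT : 0 < T) {w : ℂ} (hw : ‖w - T‖ ≤ 7 / 10 * T) :
    w ∈ Complex.slitPlane := by
  refine Complex.mem_slitPlane_iff.2 (Or.inl ?_)
  have := (Complex.abs_re_le_norm (w - T)).trans hw
  rw [Complex.sub_re, Complex.ofReal_re] at this
  linarith [(abs_le.1 this).1]

lemma le_norm_of_norm_sub_le {T r : ℝ} {w : ℂ} (hw : ‖w - T‖ ≤ r) : T - r ≤ ‖w‖ := by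
  have := norm_sub_norm_le (T : ℂ) w
  rw [norm_sub_rev, Complex.norm_real] at this
  linarith [Real.le_norm_self T]

/-- The logarithm is Lipschitz on the disk of radius `7T/10` about `T`. -/
lemma norm_log_sub_log_le {T : ℝ} (hT : 0 < T) {w w' : ℂ} (hw : ‖w - T‖ ≤ 7 / 10 * T)
    (hw' : ‖w' - T‖ ≤ 7 / 10 * T) :
    ‖Complex.log w - Complex.log w'‖ ≤ (3 / 10 * T)⁻¹ * ‖w - w'‖ := by
  refine (convex_closedBall (T : ℂ) (7 / 10 * T)).norm_image_sub_le_of_norm_hasDerivWithin_le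
    (f' := fun z => z⁻¹) (fun z hz => ?_) (fun z hz => ?_) ?_ ?_
  · exact (Complex.hasDerivAt_log (mem_slitPlane_of_norm_sub_le hT
      (mem_closedBall_iff_norm.1 hz))).hasDerivWithinAt
  · have := le_norm_of_norm_sub_le (mem_closedBall_iff_norm.1 hz)
    rw [norm_inv]
    exact inv_anti₀ (by positivity) (by linarith)
  · exact mem_closedBall_iff_norm.2 hw'
  · exact mem_closedBall_iff_norm.2 hw

lemma E_L (κ : ℂ) (j : ℤ) {z : ℂ} (hz : z ≠ 0) : E κ (L κ j z) = z := by
  have : L κ j z + κ = Complex.log z + j * (2 * Real.pi * Complex.I) := by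
    simp only [L]; ring
  rw [E, this, Complex.exp_add, Complex.exp_int_mul_two_pi_mul_I, mul_one, Complex.exp_log hz]

/-! ### Convergence of the approximations at high potentials. -/

section Tail

variable {κ : ℂ} {s : ℕ → ℤ} {t : ℝ}

lemma log_norm_add_three_pos (κ : ℂ) : 0 < Real.log (‖κ‖ + 3) :=
  Real.log_pos (by linarith [norm_nonneg κ])

lemma le_F_of_tailStart_le (ht : tailStart κ s ≤ t) :
    (F (tStar s) + 1) * (‖κ‖ + 3) ^ 2 ≤ F t + 1 := by
  have h := Real.exp_le_exp.2 ht
  have h3 : (0 : ℝ) < ‖κ‖ + 3 := by positivity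
  rw [tailStart, Real.exp_add, two_mul, Real.exp_add, Real.exp_log h3] at h
  simp only [F, sub_add_cancel]
  linarith

lemma pos_of_tailStart_le (ht : tailStart κ s ≤ t) : 0 < t := by
  have := tStar_nonneg s
  have := log_norm_add_three_pos κ
  rw [tailStart] at ht
  linarith

lemma tailStart_shift_le (hs : ExpBounded s) (ht : tailStart κ s ≤ t) :
    tailStart κ (shift s) ≤ F t := by
  have h0 := (strictMono_F.monotone ht)
  have h1 := log_norm_add_three_pos κ
  have h2 := add_F_le (tStar_nonneg s) (show 0 ≤ 2 * Real.log (‖κ‖ + 3) by linarith)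
  have h3 := self_le_F (2 * Real.log (‖κ‖ + 3))
  have h4 := hs.tStar_shift_le
  rw [tailStart] at h0 ⊢
  linarith

lemma le_F_of_tailStart_le' (hs : ExpBounded s) (ht : tailStart κ s ≤ t) :
    (|(shift s 0 : ℝ)| + 1) * (‖κ‖ + 3) ^ 2 ≤ F t + 1 := by
  have h1 : |(shift s 0 : ℝ)| ≤ F (tStar s) := hs.abs_le 1
  have h2 := le_F_of_tailStart_le ht
  nlinarith [sq_nonneg (‖κ‖ + 3)]

lemma eight_le_F (ht : tailStart κ s ≤ t) : 8 ≤ F t := by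
  have h1 := F_nonneg (tStar_nonneg s)
  have h2 := le_F_of_tailStart_le ht
  nlinarith [norm_nonneg κ]

/-- A bound for the distance of a point of potential `t` on the ray from `t`. -/
noncomputable def tailRadius (κ : ℂ) (s : ℕ → ℤ) : ℝ := ‖κ‖ + 2 * Real.pi * |(s 0 : ℝ)| + 3

/-- For κ = 0 the coefficients of |s₂| are 2π and 7/10 · 9 = 6.3, so 7/10 is nearly sharp and π must
be bounded numerically. -/
lemma tailRadius_shift_le (hs : ExpBounded s) (ht : tailStart κ s ≤ t) :
    tailRadius κ (shift s) ≤ 7 / 10 * F t := by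
  have h := le_F_of_tailStart_le' hs ht
  have h1 := abs_nonneg (shift s 0 : ℝ)
  have h2 := norm_nonneg κ
  have h3 := Real.pi_lt_d4
  rw [tailRadius]
  nlinarith [mul_nonneg h1 h2, mul_nonneg h1 (mul_nonneg h2 h2),
    mul_le_mul_of_nonneg_right h3.le h1]

lemma norm_L_sub_le (κ : ℂ) (j : ℤ) (z u : ℂ) :
    ‖L κ j z - u‖ ≤ ‖Complex.log z - u‖ + (‖κ‖ + 2 * Real.pi * |(j : ℝ)|) := by
  have e : L κ j z - u = (Complex.log z - u) + (-κ + 2 * Real.pi * Complex.I * j) := by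
    simp only [L]; ring
  rw [e]
  refine (norm_add_le _ _).trans (add_le_add_right ((norm_add_le _ _).trans ?_) _)
  simp [abs_of_pos Real.pi_pos]

lemma norm_log_ofReal_F_sub_le (ht : 8 ≤ F t) : ‖Complex.log (F t) - t‖ ≤ 1 / 8 := by
  have hF : 0 < F t := by linarith
  rw [← Complex.ofReal_log hF.le, ← Complex.ofReal_sub, Complex.norm_real, Real.norm_eq_abs]
  have h1 : Real.log (F t) ≤ t := by
    rw [Real.log_le_iff_le_exp hF]; simp [F]
  rw [abs_of_nonpos (by linarith)]
  have h2 : Real.log ((F t + 1) / F t) = t - Real.log (F t) := by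
    rw [Real.log_div (by positivity) hF.ne']
    simp [F]
  have h3 := Real.log_le_sub_one_of_pos (show 0 < (F t + 1) / F t by positivity)
  have h4 : (F t + 1) / F t - 1 ≤ 1 / 8 := by
    rw [sub_le_iff_le_add, div_le_iff₀ hF]; linarith
  linarith

/-- The bound reproduces itself: a deviation of at most 7F(t)/10 becomes at most 7/3 under the
logarithm, log F(t) is within 1/8 of t, and 7/3 + 1/8 < 3. -/
lemma norm_approx_sub_le (hs : ExpBounded s) (ht : tailStart κ s ≤ t) (m : ℕ) :
    ‖approx κ m s t - t‖ ≤ tailRadius κ s := by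
  induction m generalizing s t with
  | zero =>
    have := Real.pi_pos
    simp only [approx, sub_self, norm_zero, tailRadius]; positivity
  | succ m ih =>
    have h8 := eight_le_F ht
    have hT : 0 < F t := by linarith
    have h1 := (ih hs.shift (tailStart_shift_le hs ht)).trans (tailRadius_shift_le hs ht)
    have h2 := norm_log_sub_log_le hT h1 (w' := F t) (by simp; linarith)
    have h3 : (3 / 10 * F t)⁻¹ * ‖approx κ m (shift s) (F t) - F t‖ ≤ 7 / 3 := by
      rw [inv_mul_le_iff₀ (by positivity)]; linarith
    have h4 := norm_log_ofReal_F_sub_le h8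
    have h5 := norm_sub_le_norm_sub_add_norm_sub
      (Complex.log (approx κ m (shift s) (F t))) (Complex.log (F t)) t
    have h6 := norm_L_sub_le κ (s 0) (approx κ m (shift s) (F t)) t
    simp only [approx, tailRadius]
    linarith

lemma norm_approx_shift_sub_le (hs : ExpBounded s) (ht : tailStart κ s ≤ t) (m : ℕ) :
    ‖approx κ m (shift s) (F t) - F t‖ ≤ 7 / 10 * F t :=
  (norm_approx_sub_le hs.shift (tailStart_shift_le hs ht) m).trans (tailRadius_shift_le hs ht)

lemma approx_shift_mem_slitPlane (hs : ExpBounded s) (ht : tailStart κ s ≤ t) (m : ℕ) :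
    approx κ m (shift s) (F t) ∈ Complex.slitPlane :=
  mem_slitPlane_of_norm_sub_le (by linarith [eight_le_F ht]) (norm_approx_shift_sub_le hs ht m)

lemma E_approx_succ (hs : ExpBounded s) (ht : tailStart κ s ≤ t) (m : ℕ) :
    E κ (approx κ (m + 1) s t) = approx κ m (shift s) (F t) :=
  E_L κ _ (Complex.slitPlane_ne_zero (approx_shift_mem_slitPlane hs ht m))

lemma norm_approx_succ_sub_approx_succ_le (hs : ExpBounded s) (ht : tailStart κ s ≤ t)
    (m n : ℕ) :
    ‖approx κ (m + 1) s t - approx κ (n + 1) s t‖ ≤ (3 / 10 * F t)⁻¹ *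
      ‖approx κ m (shift s) (F t) - approx κ n (shift s) (F t)‖ := by
  have := norm_log_sub_log_le (by linarith [eight_le_F ht])
    (norm_approx_shift_sub_le hs ht m) (norm_approx_shift_sub_le hs ht n)
  simpa only [approx, L, add_sub_add_right_eq_sub, sub_sub_sub_cancel_right] using this

/-- Each logarithm contracts by at least 10/24 < 1/2, as F(t) ≥ 8. The difference of the first two
approximations is bounded only in terms of s; one logarithm makes it at most 7/3, hence the index
offset. -/
lemma norm_approx_add_two_sub_le (hs : ExpBounded s) (ht : tailStart κ s ≤ t) (m : ℕ) :
    ‖approx κ (m + 2) s t - approx κ (m + 1) s t‖ ≤ 3 * (1 / 2) ^ m := by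
  induction m generalizing s t with
  | zero =>
    refine (norm_approx_succ_sub_approx_succ_le hs ht 1 0).trans ?_
    have h := norm_approx_shift_sub_le hs ht 1
    have h8 := eight_le_F ht
    rw [inv_mul_le_iff₀ (by positivity)]
    simp only [approx] at h ⊢
    linarith
  | succ m ih =>
    refine (norm_approx_succ_sub_approx_succ_le hs ht (m + 2) (m + 1)).trans ?_
    have h := ih hs.shift (tailStart_shift_le hs ht)
    have h8 := eight_le_F ht
    have hp : (0 : ℝ) < (1 / 2) ^ m := by positivity
    rw [inv_mul_le_iff₀ (by positivity), pow_succ]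
    nlinarith

/-- The limit of the approximations `g^n_{κ,s}(t)`, which exists for `t ≥ t_s^K`. -/
noncomputable def tailRay (κ : ℂ) (s : ℕ → ℤ) (t : ℝ) : ℂ :=
  limUnder atTop fun m => approx κ m s t

lemma tendsto_approx_succ (hs : ExpBounded s) (ht : tailStart κ s ≤ t) :
    Tendsto (fun m => approx κ (m + 1) s t) atTop (𝓝 (tailRay κ s t)) := by
  have hc : CauchySeq fun m => approx κ (m + 1) s t := by
    refine cauchySeq_of_le_geometric (1 / 2) 3 (by norm_num) fun m => ?_
    rw [dist_comm, dist_eq_norm]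
    exact norm_approx_add_two_sub_le hs ht m
  obtain ⟨z, hz⟩ := cauchySeq_tendsto_of_complete hc
  have hz' : Tendsto (fun m => approx κ m s t) atTop (𝓝 z) :=
    (tendsto_add_atTop_iff_nat (f := fun m => approx κ m s t) 1).1 hz
  rwa [tailRay, hz'.limUnder_eq]

lemma tendsto_approx (hs : ExpBounded s) (ht : tailStart κ s ≤ t) :
    Tendsto (fun m => approx κ m s t) atTop (𝓝 (tailRay κ s t)) :=
  (tendsto_add_atTop_iff_nat (f := fun m => approx κ m s t) 1).1 (tendsto_approx_succ hs ht)

lemma tendstoUniformlyOn_approx (hs : ExpBounded s) :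
    TendstoUniformlyOn (fun m => approx κ (m + 1) s) (tailRay κ s) atTop
      (Ici (tailStart κ s)) := by
  rw [Metric.tendstoUniformlyOn_iff]
  intro ε hε
  have hlim : Tendsto (fun m : ℕ => 3 * (1 / 2 : ℝ) ^ m / (1 - 1 / 2)) atTop (𝓝 0) := by
    have := (tendsto_pow_atTop_nhds_zero_of_lt_one (r := (1 / 2 : ℝ)) (by norm_num)
      (by norm_num)).const_mul 3 |>.div_const (1 - 1 / 2)
    simpa using this
  filter_upwards [hlim.eventually_lt_const hε] with m hm t ht
  rw [dist_comm]
  refine (dist_le_of_le_geometric_of_tendsto (1 / 2) 3 (by norm_num) (fun m => ?_)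
    (tendsto_approx_succ hs ht) m).trans_lt hm
  rw [dist_comm, dist_eq_norm]
  exact norm_approx_add_two_sub_le hs ht m

lemma continuousOn_approx (hs : ExpBounded s) (m : ℕ) :
    ContinuousOn (approx κ m s) (Ici (tailStart κ s)) := by
  induction m generalizing s with
  | zero => exact Complex.continuous_ofReal.continuousOn
  | succ m ih =>
    have h1 : ContinuousOn (fun t => approx κ m (shift s) (F t)) (Ici (tailStart κ s)) :=
      (ih hs.shift).comp continuous_F.continuousOn fun t ht => tailStart_shift_le hs ht
    exact ((h1.clog fun t ht => approx_shift_mem_slitPlane hs ht m).sub continuousOn_const).add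
      continuousOn_const

lemma continuousOn_tailRay (hs : ExpBounded s) :
    ContinuousOn (tailRay κ s) (Ici (tailStart κ s)) :=
  (tendstoUniformlyOn_approx hs).continuousOn
    (Frequently.of_forall fun m => continuousOn_approx hs (m + 1))

lemma continuous_E (κ : ℂ) : Continuous (E κ) :=
  Complex.continuous_exp.comp (continuous_id.add continuous_const)

lemma E_tailRay (hs : ExpBounded s) (ht : tailStart κ s ≤ t) :
    E κ (tailRay κ s t) = tailRay κ (shift s) (F t) := by
  have h1 := ((continuous_E κ).tendsto _).comp (tendsto_approx_succ hs ht)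
  have h2 := tendsto_approx hs.shift (tailStart_shift_le hs ht)
  refine tendsto_nhds_unique h1 (h2.congr fun m => (E_approx_succ hs ht m).symm)

lemma iterate_E_tailRay (hs : ExpBounded s) (ht : tailStart κ s ≤ t) (n : ℕ) :
    (E κ)^[n] (tailRay κ s t) = tailRay κ (shift^[n] s) (F^[n] t) := by
  induction n generalizing s t with
  | zero => rfl
  | succ n ih =>
    rw [Function.iterate_succ_apply, E_tailRay hs ht, ih hs.shift (tailStart_shift_le hs ht)]
    rfl

lemma isRayOn_tailRay (hs : ExpBounded s) (ht : tailStart κ s ≤ t) :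
    IsRayOn κ s t (tailRay κ s) := by
  refine ⟨(continuousOn_tailRay hs).mono (Ici_subset_Ici.2 ht), fun τ hτ n hn => ?_⟩
  rw [iterate_E_tailRay hs (ht.trans hτ)]
  exact tendsto_approx (hs.iterate_shift n) hn

end Tail

/-- Two continuous functions with the same exponential on a preconnected set that agree at one
point agree on the whole set. -/
lemma eqOn_of_exp_eqOn {X : Type*} [TopologicalSpace X] {S : Set X} (hS : IsPreconnected S)
    {u v : X → ℂ} (hu : ContinuousOn u S) (hv : ContinuousOn v S)
    (h : ∀ x ∈ S, Complex.exp (u x) = Complex.exp (v x)) {a : X} (ha : a ∈ S)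
    (hua : u a = v a) : EqOn u v S :=
  Complex.isCoveringMap_exp.eqOn_of_comp_eqOn hS hu hv (fun x hx => Subtype.ext (h x hx)) ha hua

/-! ### The minimal potential t_s. -/

section MinPotential

variable {s : ℕ → ℤ} {t : ℝ}

lemma bddBelow_minPotential (s : ℕ → ℤ) :
    BddBelow {x : ℝ | 0 < x ∧ Tendsto (fun n : ℕ => |(s n : ℝ)| / F^[n] x) atTop (𝓝 0)} :=
  ⟨0, fun _ hx => hx.1.le⟩

lemma tendsto_abs_div_iterate_F (hs : ExpBounded s) {x : ℝ} (hx : tStar s < x) :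
    Tendsto (fun n : ℕ => |(s n : ℝ)| / F^[n] x) atTop (𝓝 0) := by
  have h0 := tStar_nonneg s
  have h1 := tendsto_iterate_F (h0.trans_lt hx)
  rw [tendsto_order]
  refine ⟨fun a ha => Eventually.of_forall fun n => ha.trans_le
    (div_nonneg (abs_nonneg _) (iterate_F_nonneg (h0.trans hx.le) n)), fun ε hε => ?_⟩
  filter_upwards [eventually_iterate_F_lt h0 hx (inv_nonneg.2 hε.le) 0,
    h1.eventually_gt_atTop 0] with n hn hpos
  have := hs.abs_le n
  rw [div_lt_iff₀ hpos]
  rw [add_zero, inv_mul_lt_iff₀ hε] at hn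
  linarith

lemma minPotential_le_tStar (hs : ExpBounded s) : minPotential s ≤ tStar s :=
  le_of_forall_gt_imp_ge_of_dense fun _ hx => csInf_le (bddBelow_minPotential s)
    ⟨(tStar_nonneg s).trans_lt hx, tendsto_abs_div_iterate_F hs hx⟩

lemma exists_of_minPotential_lt (hs : ExpBounded s) (ht : minPotential s < t) :
    ∃ x, 0 < x ∧ x < t ∧ Tendsto (fun n : ℕ => |(s n : ℝ)| / F^[n] x) atTop (𝓝 0) := by
  obtain ⟨x, ⟨hx, h⟩, hxt⟩ := exists_lt_of_csInf_lt ⟨tStar s + 1, by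
    have := tStar_nonneg s
    exact ⟨by linarith, tendsto_abs_div_iterate_F hs (by linarith)⟩⟩ ht
  exact ⟨x, hx, hxt, h⟩

lemma minPotential_nonneg (s : ℕ → ℤ) : 0 ≤ minPotential s :=
  Real.sInf_nonneg fun _ hx => hx.1.le

lemma minPotential_shift_lt (hs : ExpBounded s) (ht : minPotential s < t) :
    minPotential (shift s) < F t := by
  obtain ⟨x, hx, hxt, h⟩ := exists_of_minPotential_lt hs ht
  refine (csInf_le (bddBelow_minPotential _) ⟨hx.trans_le (self_le_F x), ?_⟩).trans_lt
    (strictMono_F hxt)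
  exact (tendsto_add_atTop_iff_nat (f := fun n => |(s n : ℝ)| / F^[n] x) 1).2 h

/-- Above the minimal potential, iterates are eventually above any given affine function of
`t^*`. -/
lemma exists_tStar_iterate_shift_lt (hs : ExpBounded s) (ht : minPotential s < t) {A : ℝ}
    (hA : 0 ≤ A) (B : ℝ) : ∃ N, A * tStar (shift^[N] s) + B < F^[N] t := by
  obtain ⟨x, hx, hxt, h⟩ := exists_of_minPotential_lt hs ht
  obtain ⟨N, hN⟩ := eventually_atTop.1 (h.eventually_lt_const one_pos)
  obtain ⟨n, hn, hNn⟩ := ((eventually_iterate_F_lt hx.le hxt hA B).and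
    (eventually_ge_atTop N)).exists
  refine ⟨n, lt_of_le_of_lt ?_ hn⟩
  gcongr
  -- From index n on the entries stay below the orbit of x, so t^* of σ^n s is at most F^n(x), which
  -- the orbit of t outgrows.
  refine tStar_le fun k => ?_
  have h1 := hN (n + k) (by omega)
  have hpos : 0 < F^[n + k] x := by
    simpa [Function.iterate_fixed F_zero] using iterate_F_strictMono (n + k) hx
  rw [div_lt_one hpos] at h1
  rw [iterate_shift_apply, ← Function.iterate_add_apply, add_comm k n]
  exact h1.le

end MinPotential

/-! ### Uniqueness and pull-back of rays. -/

section Rays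

variable {κ : ℂ} {s : ℕ → ℤ} {t : ℝ}

lemma IsRayOn.mono {h : ℝ → ℂ} (hh : IsRayOn κ s t h) {t' : ℝ} (ht : t ≤ t') :
    IsRayOn κ s t' h :=
  ⟨hh.1.mono (Ici_subset_Ici.2 ht), fun τ hτ => hh.2 τ (ht.trans hτ)⟩

lemma IsRayOn.eq_tailRay (hs : ExpBounded s) {h : ℝ → ℂ} (hh : IsRayOn κ s t h) {τ : ℝ}
    (hτ : t ≤ τ) (n : ℕ) (hn : tailStart κ (shift^[n] s) ≤ F^[n] τ) :
    (E κ)^[n] (h τ) = tailRay κ (shift^[n] s) (F^[n] τ) :=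
  tendsto_nhds_unique (hh.2 τ hτ n hn) (tendsto_approx (hs.iterate_shift n) hn)

lemma continuousOn_Finv : ContinuousOn Finv (Ici 0) :=
  (continuousOn_const.add continuousOn_id).log fun x (hx : 0 ≤ x) => by
    exact (show (0 : ℝ) < 1 + x by linarith).ne'

lemma le_Finv (ht : 0 ≤ t) {u : ℝ} (hu : F t ≤ u) : t ≤ Finv u := by
  simpa only [Finv_F] using Finv_mono (F_nonneg ht) hu

/-- The image of a ray under `E_κ` is the ray at the shifted address. -/
lemma IsRayOn.shift {h : ℝ → ℂ} (ht : 0 ≤ t) (hh : IsRayOn κ s t h) :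
    IsRayOn κ (shift s) (F t) fun u => E κ (h (Finv u)) := by
  refine ⟨(continuous_E κ).comp_continuousOn (hh.1.comp (continuousOn_Finv.mono
    (Ici_subset_Ici.2 (F_nonneg ht))) fun u hu => le_Finv ht hu), fun u hu n hn => ?_⟩
  have h1 := hh.2 (Finv u) (le_Finv ht hu) (n + 1)
  have hu' : F (Finv u) = u := F_Finv (by linarith [F_nonneg ht, show F t ≤ u from hu])
  simp only [Function.iterate_succ_apply, hu'] at h1
  exact h1 hn

/-- Rays are unique. -/
lemma IsRayOn.eqOn (hs : ExpBounded s) (ht0 : 0 ≤ t) {N : ℕ}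
    (hN : tailStart κ (ExpRay.shift^[N] s) ≤ F^[N] t) {h h' : ℝ → ℂ} (hh : IsRayOn κ s t h)
    (hh' : IsRayOn κ s t h') : EqOn h h' (Ici t) := by
  induction N generalizing s t h h' with
  | zero =>
    intro τ hτ
    have hτ' : tailStart κ s ≤ τ := le_trans hN hτ
    exact (hh.eq_tailRay hs hτ 0 hτ').trans (hh'.eq_tailRay hs hτ 0 hτ').symm
  | succ N ih =>
    have h1 := ih hs.shift (F_nonneg ht0) hN (hh.shift ht0) (hh'.shift ht0)
    have h2 : EqOn (fun τ => h τ + κ) (fun τ => h' τ + κ) (Ici t) := by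
      -- Base point for unique lifting: at this potential both functions are given by the
      -- approximations.
      have hT : t ≤ max t (tailStart κ s) := le_max_left _ _
      refine eqOn_of_exp_eqOn isPreconnected_Ici (hh.1.add continuousOn_const)
        (hh'.1.add continuousOn_const) (fun τ hτ => ?_) hT ?_
      · have h3 := h1 (strictMono_F.monotone hτ : F τ ∈ Ici (F t))
        simp only [Finv_F] at h3
        exact h3
      · have h3 := hh.eq_tailRay hs hT 0 (le_max_right _ _)
        have h4 := hh'.eq_tailRay hs hT 0 (le_max_right _ _)
        exact congrArg (· + κ) (h3.trans h4.symm)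
    intro τ hτ
    simpa using h2 hτ

lemma exists_tailStart_iterate_shift_lt (κ : ℂ) (hs : ExpBounded s) (ht : minPotential s < t) :
    ∃ N, tailStart κ (shift^[N] s) < F^[N] t := by
  simpa only [one_mul, tailStart] using exists_tStar_iterate_shift_lt hs ht zero_le_one
    (2 * Real.log (‖κ‖ + 3))

lemma IsRayPoint.unique (hs : ExpBounded s) {z w : ℂ} (hz : IsRayPoint κ s t z)
    (hw : IsRayPoint κ s t w) : z = w := by
  obtain ⟨ht, h, hh, rfl⟩ := hz
  obtain ⟨-, h', hh', rfl⟩ := hw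
  obtain ⟨N, hN⟩ := exists_tailStart_iterate_shift_lt κ hs ht
  exact hh.eqOn hs ((minPotential_nonneg s).trans ht.le) hN.le hh' (mem_Ici.2 le_rfl)

lemma IsRayPoint.dynRay_eq (hs : ExpBounded s) {z : ℂ} (hz : IsRayPoint κ s t z) :
    dynRay κ s t = z :=
  (Classical.epsilon_spec (p := IsRayPoint κ s t) ⟨z, hz⟩ : IsRayPoint κ s t _).unique hs hz

lemma IsRayOn.dynRay_eq (hs : ExpBounded s) {h : ℝ → ℂ} (hh : IsRayOn κ s t h) {τ : ℝ}
    (hτ : t ≤ τ) (hτ' : minPotential s < τ) : dynRay κ s τ = h τ :=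
  IsRayPoint.dynRay_eq hs ⟨hτ', h, hh.mono hτ, rfl⟩

lemma shift_mem_rayDomain (hs : ExpBounded s) (ht : t ∈ rayDomain κ s) :
    F t ∈ rayDomain κ (shift s) :=
  ⟨minPotential_shift_lt hs ht.1, fun n _ u hu => ht.2 (n + 1) (by omega) u hu⟩

/-- A nowhere vanishing continuous function on a half line has a continuous logarithm. -/
lemma exists_continuousOn_log {f : ℝ → ℂ} (hf : ContinuousOn f (Ici t))
    (h0 : ∀ τ, t ≤ τ → f τ ≠ 0) :
    ∃ g : ℝ → ℂ, ContinuousOn g (Ici t) ∧ ∀ τ, t ≤ τ → Complex.exp (g τ) = f τ := by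
  have hs : IsSimplyConnected (univ : Set ℝ) := by
    have := (convex_univ : Convex ℝ (univ : Set ℝ)).contractibleSpace univ_nonempty
    exact SimplyConnectedSpace.ofContractible (univ : Set ℝ)
  -- Extending f by its value at t replaces the half line by an open simply connected set.
  have hc : ContinuousOn (fun τ => f (max t τ)) univ :=
    hf.comp (by fun_prop) fun τ _ => mem_Ici.2 (le_max_left t τ)
  obtain ⟨g, hg, hg'⟩ := Complex.exists_continuousOn_eqOn_exp_comp hs isOpen_univ hc (by
    rintro ⟨τ, -, h⟩
    exact h0 _ (le_max_left _ _) h)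
  refine ⟨g, hg.mono (subset_univ _), fun τ hτ => ?_⟩
  simpa only [Function.comp_apply, max_eq_right hτ] using hg' (mem_univ τ)

/-- Pulling back a ray that avoids `0` along `E_κ`. -/
lemma IsRayOn.exists_pullback (hs : ExpBounded s) {h₁ : ℝ → ℂ}
    (hh : IsRayOn κ (ExpRay.shift s) (F t) h₁) (h0 : ∀ τ, t ≤ τ → h₁ (F τ) ≠ 0) :
    ∃ h, IsRayOn κ s t h := by
  obtain ⟨g, hg, hge⟩ := exists_continuousOn_log (f := fun τ => h₁ (F τ))
    (hh.1.comp continuous_F.continuousOn fun τ hτ => strictMono_F.monotone hτ) h0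
  set T := max t (tailStart κ s)
  have htail : ∀ τ, T ≤ τ → Complex.exp (tailRay κ s τ + κ) = h₁ (F τ) := fun τ hτ => by
    have h1 := E_tailRay hs ((le_max_right _ _).trans hτ : tailStart κ s ≤ τ)
    exact h1.trans (hh.eq_tailRay hs.shift
      (strictMono_F.monotone ((le_max_left _ _).trans hτ)) 0
      (tailStart_shift_le hs ((le_max_right _ _).trans hτ))).symm
  -- A logarithm is determined up to 2πik; this k makes it agree with the tail at T, hence on all of
  -- [T, ∞).
  obtain ⟨k, hk⟩ := Complex.exp_eq_exp_iff_exists_int.1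
    ((hge T (le_max_left _ _)).trans (htail T le_rfl).symm)
  have hexp : ∀ τ, t ≤ τ →
      Complex.exp (g τ - k * (2 * Real.pi * Complex.I)) = h₁ (F τ) := fun τ hτ => by
    rw [Complex.exp_sub, Complex.exp_int_mul_two_pi_mul_I, div_one, hge τ hτ]
  have heq : EqOn (fun τ => g τ - k * (2 * Real.pi * Complex.I)) (fun τ => tailRay κ s τ + κ)
      (Ici T) := by
    refine eqOn_of_exp_eqOn isPreconnected_Ici
      ((hg.mono (Ici_subset_Ici.2 (le_max_left _ _))).sub continuousOn_const)
      (((continuousOn_tailRay hs).mono (Ici_subset_Ici.2 (le_max_right _ _))).add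
        continuousOn_const)
      (fun τ hτ => ?_) (mem_Ici.2 le_rfl) (by simp only [hk]; ring)
    rw [hexp τ ((le_max_left _ _).trans hτ), htail τ hτ]
  refine ⟨fun τ => g τ - k * (2 * Real.pi * Complex.I) - κ,
    (hg.sub continuousOn_const).sub continuousOn_const, fun τ hτ n hn => ?_⟩
  cases n with
  | zero =>
    have h1 := heq (show T ≤ τ from max_le hτ hn)
    simp only at h1
    simp only [Function.iterate_zero, id, h1, add_sub_cancel_right]
    exact tendsto_approx hs hn
  | succ n =>
    have h1 := hh.2 (F τ) (strictMono_F.monotone hτ) n hn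
    rw [Function.iterate_succ_apply]
    have h2 : E κ (g τ - k * (2 * Real.pi * Complex.I) - κ) = h₁ (F τ) := by
      simp only [E, sub_add_cancel, hexp τ hτ]
    rw [← h2] at h1
    exact h1

/-- Near every potential in its domain, the ray exists, also at slightly lower potentials. -/
lemma exists_isRayOn_of_mem_rayDomain (hs : ExpBounded s) (ht : t ∈ rayDomain κ s) :
    ∃ t₀ h, minPotential s < t₀ ∧ t₀ < t ∧ IsRayOn κ s t₀ h := by
  suffices H : ∃ t₀ h, t₀ < t ∧ IsRayOn κ s t₀ h by
    obtain ⟨t₀, h, h1, h2⟩ := H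
    obtain ⟨t₁, h3, h4⟩ := exists_between (max_lt h1 ht.1)
    exact ⟨t₁, h, (le_max_right _ _).trans_lt h3, h4, h2.mono ((le_max_left _ _).trans h3.le)⟩
  obtain ⟨N, hN⟩ := exists_tailStart_iterate_shift_lt κ hs ht.1
  induction N generalizing s t with
  | zero => exact ⟨_, _, hN, isRayOn_tailRay hs le_rfl⟩
  | succ N ih =>
    obtain ⟨t₁, h₁, ht₁, hh₁⟩ := ih hs.shift (shift_mem_rayDomain hs ht) hN
    -- This is where the exceptional potentials enter: a zero here would violate the case n = 1 of
    -- the domain condition.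
    have hne : ∀ τ, t ≤ τ → h₁ (F τ) ≠ 0 := fun τ hτ h0 =>
      have hτ' := strictMono_F.monotone hτ
      ht.2 1 le_rfl (F τ) hτ' ⟨(shift_mem_rayDomain hs ht).1.trans_le hτ', h₁,
        hh₁.mono (ht₁.le.trans hτ'), h0⟩
    have hc : ContinuousAt (fun τ => h₁ (F τ)) t :=
      ContinuousAt.comp (hh₁.1.continuousAt (Ici_mem_nhds ht₁)) continuous_F.continuousAt
    obtain ⟨t₂, ht₂, hsub⟩ := exists_Ioc_subset_of_mem_nhds
      ((hc.eventually_ne (hne t le_rfl)).and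
        (continuous_F.continuousAt.eventually (lt_mem_nhds ht₁))) ⟨t - 1, by linarith⟩
    obtain ⟨t₃, h23, h3⟩ := exists_between ht₂
    obtain ⟨h, hh⟩ := (hh₁.mono (hsub ⟨h23, h3.le⟩).2.le).exists_pullback hs fun τ hτ => by
      rcases le_total τ t with h | h
      · exact (hsub ⟨h23.trans_le hτ, h⟩).1
      · exact hne τ h
    exact ⟨t₃, h, h3, hh⟩

end Rays

/-! ### Derivatives at high potentials. -/

section Far

variable {κ : ℂ} {s : ℕ → ℤ} {t : ℝ}

/-- A potential above which the derivatives of the approximations are controlled. -/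
noncomputable def farStart (κ : ℂ) (s : ℕ → ℤ) : ℝ :=
  4 * tStar s + 4 * Real.log (‖κ‖ + 1) + 40

lemma log_norm_add_one_nonneg (κ : ℂ) : 0 ≤ Real.log (‖κ‖ + 1) :=
  Real.log_nonneg (by linarith [norm_nonneg κ])

lemma tailStart_le_farStart (κ : ℂ) (s : ℕ → ℤ) : tailStart κ s ≤ farStart κ s := by
  have h0 := norm_nonneg κ
  have h1 : Real.log (‖κ‖ + 3) ≤ Real.log (3 * (‖κ‖ + 1)) :=
    Real.log_le_log (by positivity) (by linarith)
  rw [Real.log_mul (by norm_num) (by positivity)] at h1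
  have h2 := Real.log_le_sub_one_of_pos (show (0 : ℝ) < 3 by norm_num)
  have h3 := log_norm_add_one_nonneg κ
  have h4 := tStar_nonneg s
  rw [tailStart, farStart]
  linarith

lemma tailStart_le_of_farStart_le (ht : farStart κ s ≤ t) : tailStart κ s ≤ t :=
  (tailStart_le_farStart κ s).trans ht

lemma farStart_shift_le (hs : ExpBounded s) (ht : farStart κ s ≤ t) :
    farStart κ (shift s) ≤ F t := by
  have h0 := tStar_nonneg s
  have h1 := log_norm_add_one_nonneg κ
  have h2 := add_F_le (show 0 ≤ 4 * tStar s by linarith)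
    (show 0 ≤ 4 * Real.log (‖κ‖ + 1) + 40 by linarith)
  have h3 := self_le_F (4 * Real.log (‖κ‖ + 1) + 40)
  have h4 := hs.tStar_shift_le
  have h5 := add_F_le h0 h0
  have h6 := add_F_le (show 0 ≤ tStar s + tStar s by linarith)
    (show 0 ≤ tStar s + tStar s by linarith)
  rw [show tStar s + tStar s + (tStar s + tStar s) = 4 * tStar s by ring] at h6
  have h7 := strictMono_F.monotone ht
  rw [farStart, add_assoc] at h7 ⊢
  linarith

lemma exp_ten_ge : (20000 : ℝ) ≤ Real.exp 10 := by
  have h := Real.exp_one_gt_d9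
  have h1 : (2.7 : ℝ) ^ 10 ≤ Real.exp 1 ^ 10 := by gcongr; linarith
  rw [← Real.exp_nat_mul] at h1
  norm_num at h1 ⊢
  linarith

/-- With a = e^{t/4} as unit, deviations of points from F(t)+1 = a⁴ are at most a/1000, so factors
deviate from 1 by at most a⁻³. -/
lemma F_add_one_eq (t : ℝ) : F t + 1 = Real.exp (t / 4) ^ 4 := by
  rw [← Real.exp_nat_mul]; simp only [F]; push_cast; ring_nf

lemma exp_neg_three_mul (t : ℝ) : Real.exp (-(3 * t / 4)) = (Real.exp (t / 4) ^ 3)⁻¹ := by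
  rw [← Real.exp_nat_mul, ← Real.exp_neg]; push_cast; ring_nf

lemma exp_neg_half (t : ℝ) : Real.exp (-t / 2) = (Real.exp (t / 4) ^ 2)⁻¹ := by
  rw [← Real.exp_nat_mul, ← Real.exp_neg]; push_cast; ring_nf

/-- The coefficients 4 and the constant 40 in `farStart` are fitted to t/4, with e^10 ≥ 20000. -/
lemma le_exp_of_farStart_le (ht : farStart κ s ≤ t) :
    20000 * ((‖κ‖ + 1) * (F (tStar s) + 1)) ≤ Real.exp (t / 4) := by
  have h1 : tStar s + Real.log (‖κ‖ + 1) + 10 ≤ t / 4 := by rw [farStart] at ht; linarith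
  have h2 := Real.exp_le_exp.2 h1
  have h0 : 0 < ‖κ‖ + 1 := by positivity
  rw [Real.exp_add, Real.exp_add, Real.exp_log h0] at h2
  have h3 := mul_le_mul_of_nonneg_left exp_ten_ge
    (show 0 ≤ Real.exp (tStar s) * (‖κ‖ + 1) by positivity)
  simp only [F, sub_add_cancel]
  linarith

lemma large_exp_of_farStart_le (ht : farStart κ s ≤ t) : 20000 ≤ Real.exp (t / 4) := by
  have h1 := le_exp_of_farStart_le ht
  have h2 := F_nonneg (tStar_nonneg s)
  nlinarith [norm_nonneg κ, mul_nonneg (norm_nonneg κ) h2]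

lemma tailRadius_shift_add_one_le (hs : ExpBounded s) (ht : farStart κ s ≤ t) :
    tailRadius κ (shift s) + 1 ≤ Real.exp (t / 4) / 1000 := by
  have h1 := le_exp_of_farStart_le ht
  have h2 : |(shift s 0 : ℝ)| ≤ F (tStar s) := hs.abs_le 1
  have h3 := abs_nonneg (shift s 0 : ℝ)
  have h4 := mul_le_mul_of_nonneg_right Real.pi_lt_d4.le h3
  have h5 := norm_nonneg κ
  have h6 := mul_nonneg h5 (h3.trans h2)
  rw [tailRadius]
  nlinarith

/-- The factors of the derivatives of the approximations. -/
noncomputable def derivFactor (t : ℝ) (w : ℂ) : ℂ := ((F t + 1 : ℝ) : ℂ) / w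

lemma half_le_norm (ht : farStart κ s ≤ t) {w : ℂ}
    (hw : ‖w - (F t + 1 : ℝ)‖ ≤ Real.exp (t / 4) / 1000) :
    Real.exp (t / 4) ^ 4 / 2 ≤ ‖w‖ := by
  have h1 := le_norm_of_norm_sub_le hw
  have h2 := large_exp_of_farStart_le ht
  rw [F_add_one_eq] at h1
  have h3 : Real.exp (t / 4) ≤ Real.exp (t / 4) ^ 4 := le_self_pow₀ (by linarith) (by norm_num)
  linarith

lemma norm_derivFactor_sub_one_le (ht : farStart κ s ≤ t) {w : ℂ}
    (hw : ‖w - (F t + 1 : ℝ)‖ ≤ Real.exp (t / 4) / 1000) :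
    ‖derivFactor t w - 1‖ ≤ Real.exp (-(3 * t / 4)) := by
  have h1 := half_le_norm ht hw
  have ha : 0 < Real.exp (t / 4) := Real.exp_pos _
  have h0 : 0 < ‖w‖ := lt_of_lt_of_le (by positivity) h1
  have hw0 : w ≠ 0 := norm_pos_iff.1 h0
  rw [derivFactor, div_sub_one hw0, norm_div, norm_sub_rev, exp_neg_three_mul, div_le_iff₀ h0]
  have h2 : (Real.exp (t / 4) ^ 3)⁻¹ * (Real.exp (t / 4) ^ 4 / 2) = Real.exp (t / 4) / 2 := by
    field_simp
  have h3 := mul_le_mul_of_nonneg_left h1 (show 0 ≤ (Real.exp (t / 4) ^ 3)⁻¹ by positivity)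
  linarith

lemma norm_derivFactor_sub_le (ht : farStart κ s ≤ t) {w w' : ℂ}
    (hw : ‖w - (F t + 1 : ℝ)‖ ≤ Real.exp (t / 4) / 1000)
    (hw' : ‖w' - (F t + 1 : ℝ)‖ ≤ Real.exp (t / 4) / 1000) {δ : ℝ}
    (h : ‖w - w'‖ ≤ Real.exp (t / 4) * δ) :
    ‖derivFactor t w - derivFactor t w'‖ ≤ 4 * Real.exp (-(3 * t / 4)) * δ := by
  have h1 := half_le_norm ht hw
  have h1' := half_le_norm ht hw'
  have ha : 0 < Real.exp (t / 4) := Real.exp_pos _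
  have h0 : 0 < ‖w‖ := lt_of_lt_of_le (by positivity) h1
  have h0' : 0 < ‖w'‖ := lt_of_lt_of_le (by positivity) h1'
  have hδ : 0 ≤ δ := by
    have := (norm_nonneg _).trans h
    exact nonneg_of_mul_nonneg_right this ha
  have e : derivFactor t w - derivFactor t w' = ((F t + 1 : ℝ) : ℂ) * (w' - w) / (w * w') := by
    rw [derivFactor, derivFactor]
    field_simp [norm_pos_iff.1 h0, norm_pos_iff.1 h0']
  rw [e, norm_div, norm_mul, norm_mul, Complex.norm_real, F_add_one_eq, norm_sub_rev,
    exp_neg_three_mul, div_le_iff₀ (by positivity), Real.norm_of_nonneg (by positivity)]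
  have h2 : Real.exp (t / 4) ^ 4 / 2 * (Real.exp (t / 4) ^ 4 / 2) ≤ ‖w‖ * ‖w'‖ := by gcongr
  calc Real.exp (t / 4) ^ 4 * ‖w - w'‖ ≤ Real.exp (t / 4) ^ 4 * (Real.exp (t / 4) * δ) := by
        gcongr
    _ = 4 * (Real.exp (t / 4) ^ 3)⁻¹ * δ *
        (Real.exp (t / 4) ^ 4 / 2 * (Real.exp (t / 4) ^ 4 / 2)) := by
        field_simp; ring
    _ ≤ _ := by gcongr

lemma exp_neg_half_F_le (ht : farStart κ s ≤ t) :
    Real.exp (-F t / 2) ≤ Real.exp (-(3 * t / 4)) / 2 := by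
  have h2 := large_exp_of_farStart_le ht
  have h3 := Real.add_one_le_exp (F t / 2)
  have h4 := F_add_one_eq t
  have ha : 0 < Real.exp (t / 4) ^ 3 := by positivity
  rw [neg_div, Real.exp_neg, exp_neg_three_mul,
    div_eq_mul_inv (_ ⁻¹), ← mul_inv]
  refine inv_anti₀ (by positivity) ?_
  rw [pow_succ] at h4
  nlinarith

lemma exp_neg_three_mul_le (ht : farStart κ s ≤ t) :
    20000 * Real.exp (-(3 * t / 4)) ≤ Real.exp (-t / 2) := by
  have h : Real.exp (-t / 2) = Real.exp (-(3 * t / 4)) * Real.exp (t / 4) := by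
    rw [← Real.exp_add]; ring_nf
  have := mul_le_mul_of_nonneg_left (large_exp_of_farStart_le ht)
    (Real.exp_pos (-(3 * t / 4))).le
  linarith

lemma exp_neg_half_le (ht : farStart κ s ≤ t) : Real.exp (-t / 2) ≤ 1 / 2 := by
  have h1 := large_exp_of_farStart_le ht
  rw [exp_neg_half, one_div]
  gcongr
  nlinarith

lemma norm_approx_shift_sub_F_add_one_le (hs : ExpBounded s) (ht : farStart κ s ≤ t) (m : ℕ) :
    ‖approx κ m (shift s) (F t) - (F t + 1 : ℝ)‖ ≤ Real.exp (t / 4) / 1000 := by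
  refine le_trans ?_ (tailRadius_shift_add_one_le hs ht)
  have h1 := norm_approx_sub_le hs.shift (tailStart_shift_le hs (tailStart_le_of_farStart_le ht)) m
  push_cast
  rw [← sub_sub]
  exact (norm_sub_le _ _).trans (by simpa using h1)

/-- The derivatives of the approximations `g^n_{κ,s}`. -/
noncomputable def approxDeriv (κ : ℂ) : ℕ → (ℕ → ℤ) → ℝ → ℂ
  | 0, _, _ => 1
  | n + 1, s, t =>
    approxDeriv κ n (shift s) (F t) * derivFactor t (approx κ n (shift s) (F t))

lemma hasDerivAt_approx (hs : ExpBounded s) (ht : tailStart κ s ≤ t) (m : ℕ) :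
    HasDerivAt (approx κ m s) (approxDeriv κ m s t) t := by
  induction m generalizing s t with
  | zero => exact Complex.ofRealCLM.hasDerivAt
  | succ m ih =>
    have h1 := HasDerivAt.scomp t (ih hs.shift (tailStart_shift_le hs ht)) (hasDerivAt_F t)
    have h2 := ((h1.clog_real (approx_shift_mem_slitPlane hs ht m)).sub_const κ).add_const
      (2 * Real.pi * Complex.I * s 0)
    convert! h2 using 1
    simp only [approxDeriv, derivFactor, Complex.real_smul, Function.comp]
    ring

/-- The first factor dominates: it is off by at most e^{-3t/4}, and the rest, by induction, by at
most e^{-F(t)/2}/2, which is smaller still. -/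
lemma norm_approxDeriv_sub_one_le (hs : ExpBounded s) (ht : farStart κ s ≤ t) (m : ℕ) :
    ‖approxDeriv κ m s t - 1‖ ≤ Real.exp (-t / 2) / 2 := by
  induction m generalizing s t with
  | zero => simp only [approxDeriv, sub_self, norm_zero]; positivity
  | succ m ih =>
    have h1 := ih hs.shift (farStart_shift_le hs ht)
    have h2 := norm_derivFactor_sub_one_le ht (norm_approx_shift_sub_F_add_one_le hs ht m)
    have h3 := exp_neg_half_F_le ht
    have h4 := exp_neg_three_mul_le ht
    have h5 := exp_neg_half_le ht
    have e : ∀ x y : ℂ, x * y - 1 = (x - 1) * (y - 1) + (x - 1) + (y - 1) := by intros; ring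
    rw [approxDeriv, e]
    refine (norm_add₃_le).trans ?_
    rw [norm_mul]
    nlinarith [norm_nonneg (approxDeriv κ m (shift s) (F t) - 1),
      norm_nonneg (derivFactor t (approx κ m (shift s) (F t)) - 1)]

lemma norm_approx_succ_sub_le (hs : ExpBounded s) (ht : farStart κ s ≤ t) (m : ℕ) :
    ‖approx κ (m + 1) (shift s) (F t) - approx κ m (shift s) (F t)‖ ≤
      Real.exp (t / 4) * (1 / 2) ^ m := by
  have ht' := tailStart_shift_le hs (tailStart_le_of_farStart_le ht)
  have h2 := large_exp_of_farStart_le ht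
  cases m with
  | zero =>
    have h1 := norm_approx_sub_le hs.shift ht' 1
    have h3 := tailRadius_shift_add_one_le hs ht
    simp only [approx, pow_zero, mul_one] at h1 ⊢
    linarith
  | succ m =>
    refine (norm_approx_add_two_sub_le hs.shift ht' m).trans ?_
    have hp : (0 : ℝ) < (1 / 2) ^ m := by positivity
    rw [pow_succ]
    nlinarith

/-- Split D'q' - Dq = (D' - D)q' + D(q' - q): induction at F(t) handles the first term, geometric
convergence of the approximations the second. The gain e^{-3t/4} ≤ e^{-t/2}/20000 absorbs all
constants. -/
lemma norm_approxDeriv_succ_sub_le (hs : ExpBounded s) (ht : farStart κ s ≤ t) (m : ℕ) :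
    ‖approxDeriv κ (m + 1) s t - approxDeriv κ m s t‖ ≤ Real.exp (-t / 2) * (1 / 2) ^ m := by
  induction m generalizing s t with
  | zero =>
    have := norm_approxDeriv_sub_one_le hs ht 1
    have h := Real.exp_pos (-t / 2)
    rw [pow_zero, mul_one]
    exact this.trans (by linarith)
  | succ m ih =>
    have h1 := ih hs.shift (farStart_shift_le hs ht)
    have h2 := norm_derivFactor_sub_one_le ht (norm_approx_shift_sub_F_add_one_le hs ht (m + 1))
    have h3 := exp_neg_half_F_le ht
    have h4 := exp_neg_three_mul_le ht
    have h5 := exp_neg_half_le ht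
    have h6 := norm_derivFactor_sub_le ht (norm_approx_shift_sub_F_add_one_le hs ht (m + 1))
      (norm_approx_shift_sub_F_add_one_le hs ht m) (norm_approx_succ_sub_le hs ht m)
    have h7 := norm_approxDeriv_sub_one_le hs.shift (farStart_shift_le hs ht) m
    have h8 := exp_neg_half_le (farStart_shift_le hs ht)
    rw [approxDeriv, approxDeriv]
    set D' := approxDeriv κ (m + 1) (shift s) (F t)
    set D := approxDeriv κ m (shift s) (F t)
    set q' := derivFactor t (approx κ (m + 1) (shift s) (F t))
    set q := derivFactor t (approx κ m (shift s) (F t))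
    set c := Real.exp (-(3 * t / 4))
    have hp : (0 : ℝ) < (1 / 2) ^ m := by positivity
    have hq : ‖q'‖ ≤ 2 := by
      have := norm_add_le (q' - 1) 1
      rw [sub_add_cancel, norm_one] at this
      linarith
    have hD : ‖D‖ ≤ 2 := by
      have := norm_add_le (D - 1) 1
      rw [sub_add_cancel, norm_one] at this
      linarith
    calc ‖D' * q' - D * q‖ = ‖(D' - D) * q' + D * (q' - q)‖ := by ring_nf
      _ ≤ ‖D' - D‖ * ‖q'‖ + ‖D‖ * ‖q' - q‖ := by
        refine (norm_add_le _ _).trans ?_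
        rw [norm_mul, norm_mul]
      _ ≤ (c / 2 * (1 / 2) ^ m) * 2 + 2 * (4 * c * (1 / 2) ^ m) := by
        gcongr
        exact h1.trans (by gcongr)
      _ ≤ _ := by
        have h9 := mul_le_mul_of_nonneg_right h4 hp.le
        have h10 : 0 ≤ c * (1 / 2) ^ m := by positivity
        rw [pow_succ]
        linarith

/-- The limit of the derivatives of the approximations. -/
noncomputable def farDeriv (κ : ℂ) (s : ℕ → ℤ) (t : ℝ) : ℂ :=
  limUnder atTop fun m => approxDeriv κ m s t

lemma dist_approxDeriv_le (hs : ExpBounded s) (ht : farStart κ s ≤ t) (m : ℕ) :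
    dist (approxDeriv κ m s t) (approxDeriv κ (m + 1) s t) ≤ 1 * (1 / 2) ^ m := by
  rw [dist_comm, dist_eq_norm]
  refine (norm_approxDeriv_succ_sub_le hs ht m).trans ?_
  gcongr
  linarith [exp_neg_half_le ht]

lemma tendsto_approxDeriv (hs : ExpBounded s) (ht : farStart κ s ≤ t) :
    Tendsto (fun m => approxDeriv κ m s t) atTop (𝓝 (farDeriv κ s t)) :=
  (cauchySeq_of_le_geometric (1 / 2) 1 (by norm_num) (dist_approxDeriv_le hs ht)).tendsto_limUnder

lemma tendstoUniformlyOn_approxDeriv (hs : ExpBounded s) :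
    TendstoUniformlyOn (fun m => approxDeriv κ m s) (farDeriv κ s) atTop
      (Ici (farStart κ s)) := by
  rw [Metric.tendstoUniformlyOn_iff]
  intro ε hε
  have hlim : Tendsto (fun m : ℕ => 1 * (1 / 2 : ℝ) ^ m / (1 - 1 / 2)) atTop (𝓝 0) := by
    have := (tendsto_pow_atTop_nhds_zero_of_lt_one (r := (1 / 2 : ℝ)) (by norm_num)
      (by norm_num)).const_mul 1 |>.div_const (1 - 1 / 2)
    simpa using this
  filter_upwards [hlim.eventually_lt_const hε] with m hm t ht
  rw [dist_comm]
  exact (dist_le_of_le_geometric_of_tendsto (1 / 2) 1 (by norm_num) (dist_approxDeriv_le hs ht)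
    (tendsto_approxDeriv hs ht) m).trans_lt hm

lemma continuousOn_approxDeriv (hs : ExpBounded s) (m : ℕ) :
    ContinuousOn (approxDeriv κ m s) (Ici (tailStart κ s)) := by
  induction m generalizing s with
  | zero => exact continuousOn_const
  | succ m ih =>
    have hmaps : MapsTo F (Ici (tailStart κ s)) (Ici (tailStart κ (shift s))) :=
      fun t ht => tailStart_shift_le hs ht
    refine ((ih hs.shift).comp continuous_F.continuousOn hmaps).mul (ContinuousOn.div ?_
      ((continuousOn_approx hs.shift m).comp continuous_F.continuousOn hmaps)
      fun t ht => Complex.slitPlane_ne_zero (approx_shift_mem_slitPlane hs ht m))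
    exact (Complex.continuous_ofReal.comp (continuous_F.add continuous_const)).continuousOn

lemma continuousOn_farDeriv (hs : ExpBounded s) :
    ContinuousOn (farDeriv κ s) (Ici (farStart κ s)) :=
  (tendstoUniformlyOn_approxDeriv hs).continuousOn (Frequently.of_forall fun m =>
    (continuousOn_approxDeriv hs m).mono (Ici_subset_Ici.2 (tailStart_le_farStart κ s)))

lemma hasDerivAt_tailRay (hs : ExpBounded s) (ht : farStart κ s < t) :
    HasDerivAt (tailRay κ s) (farDeriv κ s t) t :=
  hasDerivAt_of_tendstoUniformlyOn isOpen_Ioi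
    ((tendstoUniformlyOn_approxDeriv hs).mono Ioi_subset_Ici_self)
    (Eventually.of_forall fun m _ hx =>
      hasDerivAt_approx hs (tailStart_le_of_farStart_le (le_of_lt hx)) m)
    (fun _ hx => tendsto_approx hs (tailStart_le_of_farStart_le (le_of_lt hx))) ht

lemma contDiffAt_tailRay (hs : ExpBounded s) (ht : farStart κ s < t) :
    ContDiffAt ℝ 1 (tailRay κ s) t := by
  refine ContDiffOn.contDiffAt (s := Ioi (farStart κ s)) ?_ (Ioi_mem_nhds ht)
  rw [show (1 : WithTop ℕ∞) = 0 + 1 from rfl, contDiffOn_succ_iff_deriv_of_isOpen isOpen_Ioi]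
  refine ⟨fun x hx => (hasDerivAt_tailRay hs hx).differentiableAt.differentiableWithinAt,
    by simp, contDiffOn_zero.2 ?_⟩
  exact ((continuousOn_farDeriv hs).mono Ioi_subset_Ici_self).congr fun x hx =>
    (hasDerivAt_tailRay hs hx).deriv

lemma norm_farDeriv_sub_one_le (hs : ExpBounded s) (ht : farStart κ s ≤ t) :
    ‖farDeriv κ s t - 1‖ ≤ Real.exp (-t / 2) / 2 :=
  le_of_tendsto ((tendsto_approxDeriv hs ht).sub_const _).norm
    (Eventually.of_forall fun m => norm_approxDeriv_sub_one_le hs ht m)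

lemma farDeriv_ne_zero (hs : ExpBounded s) (ht : farStart κ s ≤ t) : farDeriv κ s t ≠ 0 := by
  intro h
  have h1 := norm_farDeriv_sub_one_le hs ht
  have h2 := exp_neg_half_le ht
  rw [h, zero_sub, norm_neg, norm_one] at h1
  linarith

/-! ### The infinite product at high potentials. -/

lemma norm_tailRay_shift_sub_F_add_one_le (hs : ExpBounded s) (ht : farStart κ s ≤ t) :
    ‖tailRay κ (shift s) (F t) - (F t + 1 : ℝ)‖ ≤ Real.exp (t / 4) / 1000 :=
  le_of_tendsto ((tendsto_approx hs.shift (tailStart_shift_le hs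
    (tailStart_le_of_farStart_le ht))).sub_const _).norm
    (Eventually.of_forall fun m => norm_approx_shift_sub_F_add_one_le hs ht m)

lemma tailRay_shift_ne_zero (hs : ExpBounded s) (ht : farStart κ s ≤ t) :
    tailRay κ (shift s) (F t) ≠ 0 :=
  norm_pos_iff.1 (lt_of_lt_of_le (by positivity)
    (half_le_norm ht (norm_tailRay_shift_sub_F_add_one_le hs ht)))

lemma farDeriv_eq_mul (hs : ExpBounded s) (ht : farStart κ s ≤ t) :
    farDeriv κ s t =
      farDeriv κ (shift s) (F t) * derivFactor t (tailRay κ (shift s) (F t)) := by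
  refine tendsto_nhds_unique
    ((tendsto_add_atTop_iff_nat (f := fun m => approxDeriv κ m s t) 1).2
      (tendsto_approxDeriv hs ht)) ?_
  exact (tendsto_approxDeriv hs.shift (farStart_shift_le hs ht)).mul
    (tendsto_const_nhds.div (tendsto_approx hs.shift (tailStart_shift_le hs
      (tailStart_le_of_farStart_le ht))) (tailRay_shift_ne_zero hs ht))

/-- The factors of the infinite product for the derivative. -/
noncomputable def rayFactor (κ : ℂ) (s : ℕ → ℤ) (t : ℝ) (k : ℕ) : ℂ :=
  ((F^[k + 1] t + 1 : ℝ) : ℂ) / tailRay κ (shift^[k + 1] s) (F^[k + 1] t)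

lemma norm_rayFactor_sub_one_le (hs : ExpBounded s) (ht : farStart κ s ≤ t) (k : ℕ) :
    ‖rayFactor κ s t k - 1‖ ≤ Real.exp (-(3 * t / 4)) * (1 / 2) ^ k := by
  induction k generalizing s t with
  | zero =>
    rw [pow_zero, mul_one]
    exact norm_derivFactor_sub_one_le ht (norm_tailRay_shift_sub_F_add_one_le hs ht)
  | succ k ih =>
    refine (ih hs.shift (farStart_shift_le hs ht)).trans ?_
    have h1 := exp_neg_half_F_le ht
    have h2 := exp_neg_three_mul_le (farStart_shift_le hs ht)
    have h3 := Real.exp_pos (-(3 * F t / 4))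
    rw [pow_succ']
    have hp : (0 : ℝ) < (1 / 2) ^ k := by positivity
    nlinarith

lemma prod_rayFactor_mul (hs : ExpBounded s) (ht : farStart κ s ≤ t) (n : ℕ) :
    (∏ k ∈ Finset.range n, rayFactor κ s t k) * farDeriv κ (shift^[n] s) (F^[n] t) =
      farDeriv κ s t := by
  induction n generalizing s t with
  | zero => simp
  | succ n ih =>
    rw [Finset.prod_range_succ', farDeriv_eq_mul hs ht, ← ih hs.shift (farStart_shift_le hs ht)]
    simp only [rayFactor, derivFactor, Function.iterate_succ_apply, Function.iterate_zero, id]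
    ring

lemma farStart_iterate_shift_le (hs : ExpBounded s) (ht : farStart κ s ≤ t) (n : ℕ) :
    farStart κ (shift^[n] s) ≤ F^[n] t := by
  induction n generalizing s t with
  | zero => exact ht
  | succ n ih => exact ih hs.shift (farStart_shift_le hs ht)

lemma hasProd_rayFactor (hs : ExpBounded s) (ht : farStart κ s ≤ t) :
    HasProd (rayFactor κ s t) (farDeriv κ s t) := by
  have hsum : Summable fun k => ‖rayFactor κ s t k - 1‖ :=
    Summable.of_nonneg_of_le (fun _ => norm_nonneg _) (norm_rayFactor_sub_one_le hs ht)
      (summable_geometric_two.mul_left _)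
  have hmul : Multipliable (rayFactor κ s t) := by
    simpa using multipliable_one_add_of_summable hsum
  have hpos : 0 < t := pos_of_tailStart_le (tailStart_le_of_farStart_le ht)
  have h1 : Tendsto (fun n => farDeriv κ (shift^[n] s) (F^[n] t)) atTop (𝓝 1) := by
    rw [tendsto_iff_norm_sub_tendsto_zero]
    refine squeeze_zero (fun _ => norm_nonneg _) (fun n => norm_farDeriv_sub_one_le
      (hs.iterate_shift n) (farStart_iterate_shift_le hs ht n)) ?_
    have h2 : Tendsto (fun n => -(F^[n] t) / 2) atTop atBot :=
      (tendsto_neg_atTop_atBot.comp (tendsto_iterate_F hpos)).atBot_div_const two_pos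
    simpa using (Real.tendsto_exp_atBot.comp h2).div_const 2
  -- Partial product times remainder is constantly `farDeriv κ s t`, and the remainder tends to 1,
  -- so this is the value of the product.
  have h3 := (hmul.hasProd.tendsto_prod_nat.mul h1).congr (prod_rayFactor_mul hs ht)
  rw [mul_one] at h3
  rw [← tendsto_nhds_unique h3 tendsto_const_nhds]
  exact hmul.hasProd

end Far

/-! ### Continuous logarithms of differentiable functions. -/

section Smooth

/-- By continuity Im(h τ - h t) lies in (-π, π) near t, where the principal logarithm inverts exp.
-/
lemma eventuallyEq_add_log {X : Type*} [TopologicalSpace X] {h f : X → ℂ} {t : X}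
    (hc : ContinuousAt h t) (he : ∀ᶠ τ in 𝓝 t, Complex.exp (h τ) = f τ) :
    h =ᶠ[𝓝 t] fun τ => h t + Complex.log (f τ / f t) := by
  have h1 : Tendsto (fun τ => (h τ - h t).im) (𝓝 t) (𝓝 0) := by
    have := (Complex.continuous_im.tendsto _).comp (hc.sub_const (h t))
    simpa [Function.comp_def] using this
  filter_upwards [he, h1.eventually (Ioo_mem_nhds (neg_lt_zero.2 Real.pi_pos) Real.pi_pos)]
    with τ h2 h3
  rw [← h2, ← he.self_of_nhds, ← Complex.exp_sub, Complex.log_exp h3.1 h3.2.le,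
    add_sub_cancel]

variable {h f : ℝ → ℂ} {t : ℝ}

/-- A continuous logarithm of a `C¹` function is `C¹`. -/
lemma contDiffAt_of_exp_eq (hc : ContinuousAt h t)
    (he : ∀ᶠ τ in 𝓝 t, Complex.exp (h τ) = f τ) (hf : ContDiffAt ℝ 1 f t) :
    ContDiffAt ℝ 1 h t := by
  have h0 : f t ≠ 0 := he.self_of_nhds ▸ Complex.exp_ne_zero _
  refine ContDiffAt.congr_of_eventuallyEq ?_ (eventuallyEq_add_log hc he)
  have hlog : ContDiffAt ℝ 1 Complex.log (f t / f t) := by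
    rw [div_self h0]
    exact (Complex.contDiffAt_log Complex.one_mem_slitPlane).restrict_scalars ℝ
  exact contDiffAt_const.add (ContDiffAt.comp (g := Complex.log) (f := fun τ => f τ / f t) t
    hlog (hf.div_const (f t)))

lemma hasDerivAt_of_exp_eq (hc : ContinuousAt h t)
    (he : ∀ᶠ τ in 𝓝 t, Complex.exp (h τ) = f τ) {f' : ℂ} (hf : HasDerivAt f f' t) :
    HasDerivAt h (f' / f t) t := by
  have h0 : f t ≠ 0 := he.self_of_nhds ▸ Complex.exp_ne_zero _
  have h1 := ((hf.div_const (f t)).clog_real (by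
    rw [div_self h0]; exact Complex.one_mem_slitPlane)).const_add (h t)
  rw [div_self h0, div_one] at h1
  exact h1.congr_of_eventuallyEq (eventuallyEq_add_log hc he)

end Smooth

/-! ### The derivative along the whole ray. -/

section Derivative

variable {κ : ℂ} {s : ℕ → ℤ} {t₀ t : ℝ} {h : ℝ → ℂ}

lemma contDiff_F : ContDiff ℝ 1 F := Real.contDiff_exp.sub contDiff_const

/-- Rays are continuously differentiable, with derivative given by an infinite product. -/
lemma IsRayOn.contDiffAt_and_hasProd (hs : ExpBounded s) (ht₀ : 0 ≤ t₀) (ht : t₀ < t) {N : ℕ}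
    (hN : farStart κ (ExpRay.shift^[N] s) < F^[N] t) (hh : IsRayOn κ s t₀ h) :
    ContDiffAt ℝ 1 h t ∧ ∃ d : ℂ, d ≠ 0 ∧ HasDerivAt h d t ∧
      HasProd (fun k => ((F^[k + 1] t + 1 : ℝ) : ℂ) / (E κ)^[k + 1] (h t)) d := by
  induction N generalizing s t₀ t h with
  | zero =>
    have hN' : farStart κ s < t := hN
    have he : h =ᶠ[𝓝 t] tailRay κ s := by
      filter_upwards [Ioi_mem_nhds ht, Ioi_mem_nhds hN'] with τ h1 h2
      exact hh.eq_tailRay hs (le_of_lt h1) 0 (tailStart_le_of_farStart_le (le_of_lt h2))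
    refine ⟨(contDiffAt_tailRay hs hN').congr_of_eventuallyEq he, farDeriv κ s t,
      farDeriv_ne_zero hs hN'.le, (hasDerivAt_tailRay hs hN').congr_of_eventuallyEq he, ?_⟩
    have h1 := hasProd_rayFactor hs hN'.le
    have h2 := tailStart_le_of_farStart_le hN'.le
    simp only [he.self_of_nhds, iterate_E_tailRay hs h2]
    exact h1
  | succ N ih =>
    obtain ⟨hC, d, hd, hderiv, hprod⟩ :=
      ih hs.shift (F_nonneg ht₀) (strictMono_F ht) hN (hh.shift ht₀)
    simp only [Finv_F] at hprod
    have hc : ContinuousAt (fun τ => h τ + κ) t :=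
      (hh.1.continuousAt (Ici_mem_nhds ht)).add continuousAt_const
    set g : ℝ → ℂ := fun u => E κ (h (Finv u)) with hg
    have he : ∀ᶠ τ in 𝓝 t, Complex.exp (h τ + κ) = (g ∘ F) τ :=
      Eventually.of_forall fun τ => by simp only [hg, Function.comp_apply, Finv_F, E]
    have h1 := contDiffAt_of_exp_eq hc he (ContDiffAt.comp t hC contDiff_F.contDiffAt)
    have h2 := hasDerivAt_of_exp_eq hc he (HasDerivAt.scomp t hderiv (hasDerivAt_F t))
    simp only [hg, Function.comp_apply, Finv_F, Complex.real_smul] at h2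
    have hE : E κ (h t) ≠ 0 := Complex.exp_ne_zero _
    have hF : ((F t + 1 : ℝ) : ℂ) ≠ 0 := by
      simp only [F, sub_add_cancel]
      exact_mod_cast (Real.exp_pos t).ne'
    refine ⟨by simpa using h1.sub (contDiffAt_const (c := κ)), _,
      div_ne_zero (mul_ne_zero hF hd) hE, by simpa using h2.sub_const κ, ?_⟩
    -- Splits the logarithmic derivative into the new factor, of index 0, and the product d for the
    -- shifted address.
    rw [mul_div_right_comm]
    exact HasProd.zero_mul
      (f := fun k => ((F^[k + 1] t + 1 : ℝ) : ℂ) / (E κ)^[k + 1] (h t)) hprod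

lemma IsRayPoint.shift (hs : ExpBounded s) {z : ℂ} (hz : IsRayPoint κ s t z) :
    IsRayPoint κ (ExpRay.shift s) (F t) (E κ z) := by
  obtain ⟨ht, h, hh, rfl⟩ := hz
  exact ⟨minPotential_shift_lt hs ht, _, hh.shift ((minPotential_nonneg s).trans ht.le), by
    simp only [Finv_F]⟩

lemma IsRayPoint.iterate_shift (hs : ExpBounded s) {z : ℂ} (hz : IsRayPoint κ s t z) (n : ℕ) :
    IsRayPoint κ (ExpRay.shift^[n] s) (F^[n] t) ((E κ)^[n] z) := by
  induction n generalizing s t z with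
  | zero => exact hz
  | succ n ih => exact ih hs.shift (hz.shift hs)

lemma IsRayOn.dynRay_eventuallyEq (hs : ExpBounded s) (hh : IsRayOn κ s t₀ h) (ht : t₀ < t)
    (hmin : minPotential s < t) : dynRay κ s =ᶠ[𝓝 t] h := by
  filter_upwards [Ioi_mem_nhds ht, Ioi_mem_nhds hmin] with τ h1 h2
  exact hh.dynRay_eq hs (le_of_lt h1) h2

lemma exists_farStart_iterate_shift_lt (κ : ℂ) (hs : ExpBounded s) (ht : minPotential s < t) :
    ∃ N, farStart κ (shift^[N] s) < F^[N] t := by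
  simpa only [farStart, add_assoc] using exists_tStar_iterate_shift_lt hs ht zero_le_four
    (4 * Real.log (‖κ‖ + 1) + 40)

lemma dynRay_contDiffAt_and_hasProd (hs : ExpBounded s) (ht : t ∈ rayDomain κ s) :
    ContDiffAt ℝ 1 (dynRay κ s) t ∧
      HasProd (fun k => ((F^[k + 1] t + 1 : ℝ) : ℂ) /
        dynRay κ (shift^[k + 1] s) (F^[k + 1] t)) (deriv (dynRay κ s) t) ∧
      deriv (dynRay κ s) t ≠ 0 := by
  obtain ⟨t₀, h, hmin, ht₀, hh⟩ := exists_isRayOn_of_mem_rayDomain hs ht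
  obtain ⟨N, hN⟩ := exists_farStart_iterate_shift_lt κ hs ht.1
  obtain ⟨hC, d, hd, hderiv, hprod⟩ :=
    hh.contDiffAt_and_hasProd hs ((minPotential_nonneg s).trans hmin.le) ht₀ hN
  have he := hh.dynRay_eventuallyEq hs ht₀ ht.1
  have hz : IsRayPoint κ s t (h t) := ⟨ht.1, h, hh.mono ht₀.le, rfl⟩
  rw [(hderiv.congr_of_eventuallyEq he).deriv]
  refine ⟨hC.congr_of_eventuallyEq he, ?_, hd⟩
  simpa only [fun k => (hz.iterate_shift hs (k + 1)).dynRay_eq (hs.iterate_shift _)] using hprod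

lemma continuousAt_deriv_of_contDiffAt {f : ℝ → ℂ} (hf : ContDiffAt ℝ 1 f t) :
    ContinuousAt (deriv f) t := by
  have h1 : ContDiffAt ℝ 0 (fderiv ℝ f) t := hf.fderiv_right (by norm_num)
  exact h1.continuousAt.clm_apply continuousAt_const

/-- A potential t' ≥ F^{k+1}(t) is F of some potential at least F^k(t), still above `farStart` of
σ^k s; there the shifted ray is close to t' + 1, hence not 0. -/
lemma mem_rayDomain_of_farStart_le (hs : ExpBounded s) (ht : farStart κ s ≤ t) :
    t ∈ rayDomain κ s := by
  refine ⟨(minPotential_le_tStar hs).trans_lt ?_, fun n hn t' ht' hz => ?_⟩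
  · have h1 := log_norm_add_one_nonneg κ
    have h2 := tStar_nonneg s
    rw [farStart] at ht
    linarith
  · obtain ⟨k, rfl⟩ : ∃ k, n = k + 1 := ⟨n - 1, by omega⟩
    have hu := farStart_iterate_shift_le hs ht k
    have hpos : 0 < F^[k] t := pos_of_tailStart_le (tailStart_le_of_farStart_le hu)
    rw [Function.iterate_succ_apply'] at ht' hz
    have hle : farStart κ (shift^[k] s) ≤ Finv t' := hu.trans (le_Finv hpos.le ht')
    have hF : F (Finv t') = t' := F_Finv (by linarith [F_nonneg hpos.le])
    have hsk := hs.iterate_shift k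
    obtain ⟨-, h, hh, h0⟩ := hz
    have h1 := tailStart_le_of_farStart_le (farStart_shift_le hsk hle)
    have h2 := tailRay_shift_ne_zero hsk hle
    rw [hF] at h1 h2
    exact h2 ((hh.eq_tailRay hsk.shift le_rfl 0 h1).symm.trans h0)

lemma norm_deriv_dynRay_sub_one_lt (hs : ExpBounded s) (ht : farStart κ s < t) :
    ‖deriv (dynRay κ s) t - 1‖ < Real.exp (-t / 2) := by
  have he := (isRayOn_tailRay hs (tailStart_le_farStart κ s)).dynRay_eventuallyEq hs ht
    (mem_rayDomain_of_farStart_le hs ht.le).1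
  rw [((hasDerivAt_tailRay hs ht).congr_of_eventuallyEq he).deriv]
  have := Real.exp_pos (-t / 2)
  exact (norm_farDeriv_sub_one_le hs ht.le).trans_lt (by linarith)

/-- From ‖κ‖ + 1 ≤ 2K and 4 log 2 ≤ 4; the constant 45 > 40 + 4 makes the inequality strict. -/
lemma farStart_lt_of_norm_le {K : ℝ} (hK : 1 ≤ K) (hκ : ‖κ‖ ≤ K)
    (ht : 4 * tStar s + 4 * Real.log K + 45 ≤ t) : farStart κ s < t := by
  have h1 : Real.log (‖κ‖ + 1) ≤ Real.log (2 * K) :=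
    Real.log_le_log (by positivity) (by linarith)
  rw [Real.log_mul (by norm_num) (by positivity)] at h1
  have h2 := Real.log_le_sub_one_of_pos (show (0 : ℝ) < 2 by norm_num)
  rw [farStart]
  linarith

end Derivative

end ExpRay

theorem proposition4p5 :
    (∀ (κ : ℂ) (s : ℕ → ℤ), ExpRay.ExpBounded s →
      (∀ t ∈ ExpRay.rayDomain κ s,
        DifferentiableAt ℝ (ExpRay.dynRay κ s) t ∧
        HasProd (fun k : ℕ =>
            (((ExpRay.F^[k + 1] t + 1 : ℝ) : ℂ) /
              ExpRay.dynRay κ (ExpRay.shift^[k + 1] s) (ExpRay.F^[k + 1] t)))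
          (deriv (ExpRay.dynRay κ s) t) ∧
        deriv (ExpRay.dynRay κ s) t ≠ 0) ∧
      ContinuousOn (deriv (ExpRay.dynRay κ s)) (ExpRay.rayDomain κ s)) ∧
    ExpRay.OnRayTails (fun κ s t =>
      t ∈ ExpRay.rayDomain κ s ∧
        ‖deriv (ExpRay.dynRay κ s) t - 1‖ < Real.exp (-t / 2)) := by
  refine ⟨fun κ s hs => ⟨fun t ht => ?_, fun t ht => ?_⟩,
    4, 4, 45, by norm_num, by norm_num, by norm_num, fun s hs K hK κ hκ t ht => ?_⟩
  · obtain ⟨h1, h2⟩ := ExpRay.dynRay_contDiffAt_and_hasProd hs ht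
    exact ⟨h1.differentiableAt one_ne_zero, h2⟩
  · exact (ExpRay.continuousAt_deriv_of_contDiffAt
      (ExpRay.dynRay_contDiffAt_and_hasProd hs ht).1).continuousWithinAt
  · have h := ExpRay.farStart_lt_of_norm_le hK hκ ht
    exact ⟨ExpRay.mem_rayDomain_of_farStart_le hs h.le,
      ExpRay.norm_deriv_dynRay_sub_one_lt hs h⟩
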